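/- Let $a,b,c$ be positive integers. Use oblique coordinates in the plane in which the basis vector $(1,0)$ is the unit vector pointing $30^\circ$ below the horizontal to the right and $(0,1)$ is the unit vector pointing vertically upwards, and consider the hexagon with all angles $120^\circ$ and side lengths $a,b,c,a,b,c$ whose vertices are, in these coordinates, $(0,0),(b,0),(a+b,a),(a+b,a+c),(a,a+c),(0,c)$. It is divided into unit equilateral triangles by the triangular lattice whose vertices are the points with integer coordinates. A lozenge is the union of two of these triangles that share an edge; it is called horizontal if its long diagonal is horizontal. Let $P_{a,b,c}(x,y)$ denote the probability that a uniformly random lozenge tiling of this hexagon contains the horizontal lozenge with lowest vertex $(x,y)$. Let $x_0$ be an integer with $1\le x_0\le a+b-1$. If $a\le b$, then $$\sum_{y=0}^{a+c-1} P_{a,b,c}(x_0,y)\left(y-\frac{a+c-1}{2}\right)=\begin{cases} \dfrac{(-a^2-ab-ac+bc+ax_0+bx_0)\,x_0}{2(a+b)} & \text{if } 1\le x_0\le a,\\[2mm] \dfrac{ac\,(a+b-2x_0)}{2(a+b)} & \text{if } a\le x_0\le b,\\[2mm] \dfrac{(-b^2-ab-bc+ac+ax_0+bx_0)(a+b-x_0)}{2(a+b)}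 & \text{if } b\le x_0\le a+b-1, \end{cases}$$ and if $a\ge b$, then $$\sum_{y=0}^{a+c-1} P_{a,b,c}(x_0,y)\left(y-\frac{a+c-1}{2}\right)=\begin{cases} \dfrac{(-a^2-ab-ac+bc+ax_0+bx_0)\,x_0}{2(a+b)} & \text{if } 1\le x_0\le b,\\[2mm] \dfrac{-b\,(a+b+c)(a+b-2x_0)}{2(a+b)} & \text{if } b\le x_0\le a,\\[2mm] \dfrac{(-b^2-ab-bc+ac+ax_0+bx_0)(a+b-x_0)}{2(a+b)} & \text{if } a\le x_0\le a+b-1. \end{cases}$$ -/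

import Mathlib

namespace LozengeHexagon

/-- Unit triangles of the triangular lattice. Lattice points are written in oblique coordinates:
`(1, 0)` is the unit vector pointing down-right at 30 degrees below the horizontal and `(0, 1)` is
the upward unit vector, so that `(1, 1)` is the unit vector pointing up-right. The lattice edges are
the translates of these three vectors; each unit parallelogram with opposite corners `(x, y)` and
`(x + 1, y + 1)` is cut by its diagonal into two unit triangles. -/
inductive UnitTriangle where
  | lower (x y : ℤ)
  | upper (x y : ℤ)
  deriving DecidableEq

/-- The three corners of a unit triangle. -/
def UnitTriangle.corners : UnitTriangle → Finset (ℤ × ℤ)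
  | .lower x y => {(x, y), (x + 1, y), (x + 1, y + 1)}
  | .upper x y => {(x, y), (x, y + 1), (x + 1, y + 1)}

/-- The lattice points of the closed hexagon with 120 degree angles and side lengths
`a, b, c, a, b, c` whose corners are, in oblique coordinates,
`(0, 0), (b, 0), (a + b, a), (a + b, a + c), (a, a + c), (0, c)`. -/
def InHexagon (a b c : ℕ) (p : ℤ × ℤ) : Prop :=
  0 ≤ p.1 ∧ p.1 ≤ a + b ∧ 0 ≤ p.2 ∧ p.2 ≤ a + c ∧ -(b : ℤ) ≤ p.2 - p.1 ∧ p.2 - p.1 ≤ c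

/-- A unit triangle lies in the (convex) hexagon iff its corners do. -/
def UnitTriangle.InHexagon (a b c : ℕ) (t : UnitTriangle) : Prop :=
  ∀ p ∈ t.corners, LozengeHexagon.InHexagon a b c p

/-- Unit lozenges of the triangular lattice: unions of two unit triangles that share an edge.
There are three orientations, according to the direction of the shared edge.
* `horizontal x y`: long diagonal horizontal, lowest vertex `(x, y)`, the other vertices being
  `(x - 1, y)`, `(x, y + 1)`, `(x + 1, y + 1)`; the shared edge is `(x, y)`–`(x, y + 1)`.
* `falling x y`: vertices `(x, y)`, `(x + 1, y)`, `(x + 1, y + 1)`, `(x, y + 1)`; the shared edge is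
  `(x, y)`–`(x + 1, y + 1)`.
* `rising x y`: vertices `(x, y)`, `(x + 1, y + 1)`, `(x + 1, y + 2)`, `(x, y + 1)`; the shared edge
  is `(x, y + 1)`–`(x + 1, y + 1)`. -/
inductive Lozenge where
  | horizontal (x y : ℤ)
  | falling (x y : ℤ)
  | rising (x y : ℤ)
  deriving DecidableEq

/-- The two unit triangles that make up a lozenge. -/
def Lozenge.triangles : Lozenge → Finset UnitTriangle
  | .horizontal x y => {.lower (x - 1) y, .upper x y}
  | .falling x y => {.lower x y, .upper x y}
  | .rising x y => {.upper x y, .lower x (y + 1)}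

/-- A lozenge tiling of the hexagon: a set of lozenges contained in the hexagon such that every
unit triangle of the hexagon is covered by exactly one of them. -/
def IsLozengeTiling (a b c : ℕ) (T : Finset Lozenge) : Prop :=
  (∀ l ∈ T, ∀ t ∈ l.triangles, t.InHexagon a b c) ∧
    ∀ t : UnitTriangle, t.InHexagon a b c → ∃! l, l ∈ T ∧ t ∈ l.triangles

/-- The set of all lozenge tilings of the hexagon; it is finite. -/
def lozengeTilings (a b c : ℕ) : Set (Finset Lozenge) :=
  {T | IsLozengeTiling a b c T}

/-- The probability that a uniformly random lozenge tiling of the hexagon contains the horizontal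
lozenge with lowest vertex `(x, y)`. -/
noncomputable def prob (a b c : ℕ) (x y : ℤ) : ℝ :=
  ({T ∈ lozengeTilings a b c | Lozenge.horizontal x y ∈ T}.ncard : ℝ) /
    ((lozengeTilings a b c).ncard : ℝ)

end LozengeHexagon

/-! A tiling is a family of `c` lattice paths running left to right through the falling and rising
lozenges. On each vertical line the positions missed by the paths ("holes") are the horizontal
lozenges centred on that line together with the positions outside the hexagon. Exactly `a` holes lie
below `a + c`, and those outside the hexagon are the same for every tiling, so the claim reduces to
the expected sum `S x` of the hole positions on line `x`.

Tilings correspond to sequences of hole sets that interlace from each line to the next, with both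
boundary lines prescribed (`tilingOf_hole`, `hole_tilingOf`). With all lines but `x + 1` fixed, the
holes on that line range independently over intervals determined by the two neighbouring lines
(`between_iff`). Reflecting every hole in its interval is an involution on tilings, and the interval
ends add up to the hole sums of the neighbouring lines (`Between.sum_add_sum_reflect`).

Averaging over all tilings gives `2 E[S (x + 1)] = E[S x] + E[S (x + 2)]` (`sum_lineSum_harmonic`).
Thus `E[S x]` is affine in `x`, and the two boundary lines determine it (`sum_lineSum`). Subtracting
the holes outside the hexagon (`sum_not_verticalEdge`) creates the case distinctions. -/

namespace LozengeHexagon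

/-! ### Interlacing sequences and the reflection between two neighbours -/

section Interlacing

open scoped Classical

/-- Two sets of natural numbers interlace: their increasing enumerations `f` and `g` satisfy
`g i ≤ f i < g (i + 1)`. The condition is expressed through the counting functions. -/
def Interlaces (p q : ℕ → Prop) : Prop :=
  ∀ y, Nat.count p y ≤ Nat.count q y ∧ Nat.count q (y + 1) ≤ Nat.count p y + 1

theorem nth_lt_iff {p : ℕ → Prop} (hp : (Set.ofPred p).Infinite) (i y : ℕ) :
    Nat.nth p i < y ↔ i < Nat.count p y := by
  have := Nat.count_le_iff_le_nth hp (a := y) (b := i)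
  omega

/-- Counting functions suit the local structure of tilings, enumerations suit the reflection;
`nth_lt_iff` translates between them. -/
theorem interlaces_iff_nth {p q : ℕ → Prop} (hp : (Set.ofPred p).Infinite) (hq : (Set.ofPred q).Infinite) :
    Interlaces p q ↔
      ∀ i, Nat.nth q i ≤ Nat.nth p i ∧ Nat.nth p i < Nat.nth q (i + 1) := by
  constructor
  · intro h i
    constructor
    · have h1 := (h (Nat.nth p i + 1)).1
      rw [Nat.count_nth_succ_of_infinite hp] at h1
      have := (nth_lt_iff hq i (Nat.nth p i + 1)).2 (by omega)
      omega
    · have h1 := (h (Nat.nth q (i + 1))).2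
      rw [Nat.count_nth_succ_of_infinite hq] at h1
      exact (nth_lt_iff hp _ _).2 (by omega)
  · intro h y
    constructor
    · by_contra! hlt
      have h1 := (nth_lt_iff hp _ _).2 hlt
      have h2 := (nth_lt_iff hq _ _).1 ((h _).1.trans_lt h1)
      omega
    · by_contra! hlt
      have h1 := (nth_lt_iff hq _ _).2 hlt
      have h2 := (h (Nat.count p y)).2
      have h3 := (nth_lt_iff hp (Nat.count p y) y).1 (by omega)
      omega

theorem sum_nth_range_count (p : ℕ → Prop) (m : ℕ) :
    ∑ i ∈ Finset.range (Nat.count p m), Nat.nth p i =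
      ∑ y ∈ Finset.range m, if p y then y else 0 := by
  induction m with
  | zero => simp
  | succ m ih =>
    rw [Finset.sum_range_succ, Nat.count_succ]
    by_cases hm : p m
    · rw [if_pos hm, Finset.sum_range_succ, ih, if_pos hm, Nat.nth_count hm]
    · rw [if_neg hm, if_neg hm, add_zero, add_zero, ih]

theorem nth_mem_range_eq {f : ℕ → ℕ} (hf : StrictMono f) (i : ℕ) :
    Nat.nth (fun y => y ∈ Set.range f) i = f i := by
  have hinf : (Set.ofPred fun y => y ∈ Set.range f).Infinite :=
    Set.infinite_range_of_injective hf.injective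
  have h := StrictMono.range_inj (Nat.nth_strictMono hinf) hf
  have h2 : Set.range (Nat.nth fun y => y ∈ Set.range f) = Set.range f :=
    Nat.range_nth_of_infinite hinf
  exact congrFun (h.1 h2) i

/-- The least value admissible at index `i` in a sequence lying between `f` and `h`. -/
def lowerEnd (f h : ℕ → ℕ) : ℕ → ℕ
  | 0 => h 0
  | i + 1 => max (h (i + 1)) (f i + 1)

/-- The greatest value admissible at index `i` in a sequence lying between `f` and `h`. -/
def upperEnd (f h : ℕ → ℕ) (i : ℕ) : ℕ := min (h (i + 1) - 1) (f i)

/-- Reflection of each entry of `g` in its interval of admissible values. -/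
def reflect (f g h : ℕ → ℕ) (i : ℕ) : ℕ := lowerEnd f h i + upperEnd f h i - g i

/-- `g` lies between `f` and `h` in the interlacing order. -/
def Between (f g h : ℕ → ℕ) : Prop :=
  (∀ i, g i ≤ f i ∧ f i < g (i + 1)) ∧ ∀ i, h i ≤ g i ∧ g i < h (i + 1)

/-- The constraints decouple: each bound on `g i` involves only `f` and `h`, so the entries vary
independently in their intervals. -/
theorem between_iff {f g h : ℕ → ℕ} (hh : ∀ i, h i < h (i + 1)) :
    Between f g h ↔ ∀ i, lowerEnd f h i ≤ g i ∧ g i ≤ upperEnd f h i := by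
  constructor
  · rintro ⟨h1, h2⟩ i
    have a1 := h1 i
    have a2 := h2 i
    refine ⟨?_, ?_⟩
    · cases i with
      | zero => exact a2.1
      | succ i =>
        have a3 := h1 i
        simp only [lowerEnd]
        omega
    · simp only [upperEnd]
      omega
  · intro H
    refine ⟨fun i => ?_, fun i => ?_⟩
    · have a1 := (H i).2
      have a2 := (H (i + 1)).1
      simp only [lowerEnd, upperEnd] at a1 a2
      omega
    · have a1 := H i
      have a3 := hh i
      simp only [upperEnd] at a1
      cases i <;> simp only [lowerEnd] at a1 <;> omega

theorem Between.strictMono {f g h : ℕ → ℕ} (H : Between f g h) : StrictMono g :=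
  strictMono_nat_of_lt_succ fun i => (H.1 i).1.trans_lt (H.1 i).2

theorem Between.reflect {f g h : ℕ → ℕ} (hh : ∀ i, h i < h (i + 1)) (H : Between f g h) :
    Between f (reflect f g h) h := by
  rw [between_iff hh] at H ⊢
  intro i
  have := H i
  simp only [LozengeHexagon.reflect]
  omega

theorem Between.reflect_reflect {f g h : ℕ → ℕ} (hh : ∀ i, h i < h (i + 1))
    (H : Between f g h) : LozengeHexagon.reflect f (LozengeHexagon.reflect f g h) h = g := by
  rw [between_iff hh] at H
  funext i
  have := H i
  simp only [LozengeHexagon.reflect]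
  omega

/-- Telescoping: a maximum and a minimum pair up to give `upperEnd f h i + lowerEnd f h (i + 1) = f
i + h (i + 1)`. -/
theorem sum_lowerEnd_add_upperEnd {f h : ℕ → ℕ} (hh : ∀ i, h i < h (i + 1)) (m : ℕ) :
    ∑ i ∈ Finset.range (m + 1), (lowerEnd f h i + upperEnd f h i) =
      ∑ i ∈ Finset.range m, (f i + h i) + h m + upperEnd f h m := by
  induction m with
  | zero => simp [lowerEnd]
  | succ m ih =>
    rw [Finset.sum_range_succ, ih, Finset.sum_range_succ]
    have := hh m
    simp only [lowerEnd, upperEnd]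
    omega

theorem Between.sum_add_sum_reflect {f g h : ℕ → ℕ} (hh : ∀ i, h i < h (i + 1))
    (H : Between f g h) {m : ℕ} (hm : ∀ i, i + 1 = m → f i < h m) :
    ∑ i ∈ Finset.range m, g i + ∑ i ∈ Finset.range m, LozengeHexagon.reflect f g h i =
      ∑ i ∈ Finset.range m, f i + ∑ i ∈ Finset.range m, h i := by
  rw [between_iff hh] at H
  have h1 : ∑ i ∈ Finset.range m, g i + ∑ i ∈ Finset.range m, LozengeHexagon.reflect f g h i =
      ∑ i ∈ Finset.range m, (lowerEnd f h i + upperEnd f h i) := by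
    rw [← Finset.sum_add_distrib]
    refine Finset.sum_congr rfl fun i _ => ?_
    have := H i
    simp only [LozengeHexagon.reflect]
    omega
  rw [h1]
  cases m with
  | zero => simp
  | succ m =>
    have h2 := hm m rfl
    rw [sum_lowerEnd_add_upperEnd hh, Finset.sum_add_distrib, Finset.sum_range_succ f,
      Finset.sum_range_succ h]
    simp only [upperEnd]
    omega

/-- The set whose enumeration is the reflection of that of `q` between those of `p` and `r`. -/
def toggle (p q r : ℕ → Prop) (y : ℕ) : Prop :=
  y ∈ Set.range (reflect (Nat.nth p) (Nat.nth q) (Nat.nth r))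

/-! ### Reflection of hole sets -/

section

variable {p q r : ℕ → Prop} (hp : (Set.ofPred p).Infinite) (hq : (Set.ofPred q).Infinite)
  (hr : (Set.ofPred r).Infinite) (hpq : Interlaces p q) (hqr : Interlaces q r)

include hp hq hr hpq hqr

theorem between_nth : Between (Nat.nth p) (Nat.nth q) (Nat.nth r) :=
  ⟨(interlaces_iff_nth hp hq).1 hpq, (interlaces_iff_nth hq hr).1 hqr⟩

theorem between_reflect_nth :
    Between (Nat.nth p) (reflect (Nat.nth p) (Nat.nth q) (Nat.nth r)) (Nat.nth r) :=
  (between_nth hp hq hr hpq hqr).reflect fun i => Nat.nth_strictMono hr (Nat.lt_succ_self i)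

theorem nth_toggle :
    Nat.nth (toggle p q r) = reflect (Nat.nth p) (Nat.nth q) (Nat.nth r) :=
  funext fun i => nth_mem_range_eq (between_reflect_nth hp hq hr hpq hqr).strictMono i

theorem toggle_infinite : (Set.ofPred (toggle p q r)).Infinite :=
  Set.infinite_range_of_injective (between_reflect_nth hp hq hr hpq hqr).strictMono.injective

theorem interlaces_toggle : Interlaces p (toggle p q r) ∧ Interlaces (toggle p q r) r := by
  have ht := toggle_infinite hp hq hr hpq hqr
  have hb := between_reflect_nth hp hq hr hpq hqr
  rw [← nth_toggle hp hq hr hpq hqr] at hb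
  exact ⟨(interlaces_iff_nth hp ht).2 hb.1, (interlaces_iff_nth ht hr).2 hb.2⟩

theorem toggle_toggle : toggle p (toggle p q r) r = q := by
  funext y
  unfold toggle
  rw [show Nat.nth (fun y => y ∈ Set.range (reflect (Nat.nth p) (Nat.nth q) (Nat.nth r))) =
    reflect (Nat.nth p) (Nat.nth q) (Nat.nth r) from nth_toggle hp hq hr hpq hqr,
    (between_nth hp hq hr hpq hqr).reflect_reflect
      fun i => Nat.nth_strictMono hr (Nat.lt_succ_self i), Nat.range_nth_of_infinite hq]
  rfl

theorem sum_add_sum_toggle {k m : ℕ} (hpm : Nat.count p m = k) (hqm : Nat.count q m = k)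
    (hrm : Nat.count r m = k) (htm : Nat.count (toggle p q r) m = k) :
    (∑ y ∈ Finset.range m, if q y then y else 0) +
      (∑ y ∈ Finset.range m, if toggle p q r y then y else 0) =
    (∑ y ∈ Finset.range m, if p y then y else 0) +
      ∑ y ∈ Finset.range m, if r y then y else 0 := by
  simp only [← sum_nth_range_count]
  rw [hpm, hqm, hrm, htm, nth_toggle hp hq hr hpq hqr]
  refine (between_nth hp hq hr hpq hqr).sum_add_sum_reflect
    (fun i => Nat.nth_strictMono hr (Nat.lt_succ_self i)) fun i hi => ?_
  -- The last counted element of `p` lies below `m`, whereas element number `k` of `r` does not,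
  -- since `r` has only `k` elements below `m`.
  have h1 := (nth_lt_iff hp i m).2 (by omega)
  have h2 := nth_lt_iff hr k m
  omega

end

end Interlacing

end LozengeHexagon

namespace LozengeHexagon

/-! ### The hexagon in terms of vertical edges -/

section Configurations

open scoped Classical

/-- The vertical edge from `(x, y)` to `(x, y + 1)` lies in the hexagon. -/
def VerticalEdge (a b c x y : ℕ) : Prop :=
  x ≤ a + b ∧ y + 1 ≤ a + c ∧ x ≤ y + b ∧ y + 1 ≤ x + c

theorem upper_inHexagon {a b c x y : ℕ} :
    (UnitTriangle.upper x y).InHexagon a b c ↔ x < a + b ∧ VerticalEdge a b c x y := by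
  simp only [UnitTriangle.InHexagon, UnitTriangle.corners, InHexagon, VerticalEdge,
    Finset.mem_insert, Finset.mem_singleton, forall_eq_or_imp, forall_eq]
  omega

theorem lower_inHexagon {a b c x y : ℕ} :
    (UnitTriangle.lower x y).InHexagon a b c ↔ VerticalEdge a b c (x + 1) y := by
  simp only [UnitTriangle.InHexagon, UnitTriangle.corners, InHexagon, VerticalEdge,
    Finset.mem_insert, Finset.mem_singleton, forall_eq_or_imp, forall_eq]
  omega

theorem nonneg_of_upper_inHexagon {a b c : ℕ} {x y : ℤ}
    (h : (UnitTriangle.upper x y).InHexagon a b c) : 0 ≤ x ∧ 0 ≤ y := by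
  have := h (x, y) (by simp [UnitTriangle.corners])
  exact ⟨this.1, this.2.2.1⟩

theorem nonneg_of_lower_inHexagon {a b c : ℕ} {x y : ℤ}
    (h : (UnitTriangle.lower x y).InHexagon a b c) : 0 ≤ x ∧ 0 ≤ y := by
  have := h (x, y) (by simp [UnitTriangle.corners])
  exact ⟨this.1, this.2.2.1⟩

/-- Both unit triangles of the lozenge lie in the hexagon. -/
def Lozenge.InHexagon (a b c : ℕ) (l : Lozenge) : Prop :=
  ∀ t ∈ l.triangles, t.InHexagon a b c

theorem horizontal_inHexagon {a b c x y : ℕ} :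
    (Lozenge.horizontal x y).InHexagon a b c ↔
      1 ≤ x ∧ x < a + b ∧ VerticalEdge a b c x y := by
  simp only [Lozenge.InHexagon, Lozenge.triangles, Finset.mem_insert, Finset.mem_singleton,
    forall_eq_or_imp, forall_eq, upper_inHexagon]
  constructor
  · rintro ⟨h1, h2, h3⟩
    have := (nonneg_of_lower_inHexagon h1).1
    exact ⟨by omega, h2, h3⟩
  · rintro ⟨h1, h2, h3⟩
    obtain ⟨x, rfl⟩ := Nat.exists_eq_add_of_le' h1
    refine ⟨?_, h2, h3⟩
    have : ((x + 1 : ℕ) : ℤ) - 1 = (x : ℤ) := by push_cast; ring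
    rw [this, lower_inHexagon]
    exact h3

theorem falling_inHexagon {a b c x y : ℕ} :
    (Lozenge.falling x y).InHexagon a b c ↔
      VerticalEdge a b c (x + 1) y ∧ VerticalEdge a b c x y := by
  simp only [Lozenge.InHexagon, Lozenge.triangles, Finset.mem_insert, Finset.mem_singleton,
    forall_eq_or_imp, forall_eq, upper_inHexagon, lower_inHexagon]
  simp only [VerticalEdge]
  omega

theorem rising_inHexagon {a b c x y : ℕ} :
    (Lozenge.rising x y).InHexagon a b c ↔
      VerticalEdge a b c x y ∧ VerticalEdge a b c (x + 1) (y + 1) := by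
  have : (y : ℤ) + 1 = ((y + 1 : ℕ) : ℤ) := by push_cast; ring
  simp only [Lozenge.InHexagon, Lozenge.triangles, Finset.mem_insert, Finset.mem_singleton,
    forall_eq_or_imp, forall_eq, upper_inHexagon, this, lower_inHexagon]
  simp only [VerticalEdge]
  omega

theorem exists_nat_horizontal {a b c : ℕ} {x y : ℤ}
    (h : (Lozenge.horizontal x y).InHexagon a b c) : ∃ m n : ℕ, x = m ∧ y = n := by
  have := nonneg_of_upper_inHexagon (h (.upper x y) (by simp [Lozenge.triangles]))
  exact ⟨x.toNat, y.toNat, by omega, by omega⟩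

theorem exists_nat_falling {a b c : ℕ} {x y : ℤ}
    (h : (Lozenge.falling x y).InHexagon a b c) : ∃ m n : ℕ, x = m ∧ y = n := by
  have := nonneg_of_upper_inHexagon (h (.upper x y) (by simp [Lozenge.triangles]))
  exact ⟨x.toNat, y.toNat, by omega, by omega⟩

theorem exists_nat_rising {a b c : ℕ} {x y : ℤ}
    (h : (Lozenge.rising x y).InHexagon a b c) : ∃ m n : ℕ, x = m ∧ y = n := by
  have := nonneg_of_upper_inHexagon (h (.upper x y) (by simp [Lozenge.triangles]))
  exact ⟨x.toNat, y.toNat, by omega, by omega⟩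

theorem finite_lozenge_inHexagon (a b c : ℕ) : {l : Lozenge | l.InHexagon a b c}.Finite := by
  have hbox := ((Finset.range (a + b + 1)) ×ˢ (Finset.range (a + c + 1))).finite_toSet
  refine (((hbox.image fun z : ℕ × ℕ => Lozenge.horizontal z.1 z.2).union
    (hbox.image fun z : ℕ × ℕ => Lozenge.falling z.1 z.2)).union
    (hbox.image fun z : ℕ × ℕ => Lozenge.rising z.1 z.2)).subset ?_
  rintro (⟨x, y⟩ | ⟨x, y⟩ | ⟨x, y⟩) hl
  · obtain ⟨m, n, rfl, rfl⟩ := exists_nat_horizontal hl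
    have := (horizontal_inHexagon.1 hl).2.2
    refine Or.inl (Or.inl ⟨(m, n), ?_, rfl⟩)
    simp only [VerticalEdge, Finset.coe_product, Finset.coe_range, Set.mem_prod, Set.mem_Iio]
      at this ⊢
    omega
  · obtain ⟨m, n, rfl, rfl⟩ := exists_nat_falling hl
    have := (falling_inHexagon.1 hl).2
    refine Or.inl (Or.inr ⟨(m, n), ?_, rfl⟩)
    simp only [VerticalEdge, Finset.coe_product, Finset.coe_range, Set.mem_prod, Set.mem_Iio]
      at this ⊢
    omega
  · obtain ⟨m, n, rfl, rfl⟩ := exists_nat_rising hl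
    have := (rising_inHexagon.1 hl).1
    refine Or.inr ⟨(m, n), ?_, rfl⟩
    simp only [VerticalEdge, Finset.coe_product, Finset.coe_range, Set.mem_prod, Set.mem_Iio]
      at this ⊢
    omega

theorem finite_lozengeTilings (a b c : ℕ) : (lozengeTilings a b c).Finite := by
  refine ((finite_lozenge_inHexagon a b c).toFinset.powerset.finite_toSet).subset ?_
  intro T hT
  simp only [Finset.coe_powerset, Set.mem_preimage, Set.mem_powerset_iff]
  intro l hl
  simp only [Set.Finite.coe_toFinset]
  exact hT.1 l hl

/-- Sequences of sets of natural numbers, one for each vertical lattice line, that are the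
positions not visited by the `c` lattice paths of a lozenge tiling. -/
structure IsConfig (a b c : ℕ) (p : ℕ → ℕ → Prop) : Prop where
  zero : ∀ y, p 0 y ↔ c ≤ y
  last : ∀ y, p (a + b) y ↔ y < a ∨ a + c ≤ y
  beyond : ∀ x y, a + b < x → p x y
  interlaces : ∀ x, x < a + b → Interlaces (p x) (p (x + 1))

/-! ### Counts forced by the two boundary lines -/

namespace IsConfig

variable {a b c : ℕ} {p : ℕ → ℕ → Prop}

theorem count_zero (h : IsConfig a b c p) (y : ℕ) : Nat.count (p 0) y = y - c := by
  induction y with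
  | zero => simp
  | succ y ih =>
    rw [Nat.count_succ, ih, h.zero]
    split_ifs <;> omega

theorem count_last (h : IsConfig a b c p) (y : ℕ) :
    Nat.count (p (a + b)) y = min y a + (y - (a + c)) := by
  induction y with
  | zero => simp
  | succ y ih =>
    rw [Nat.count_succ, ih, h.last]
    split_ifs <;> omega

theorem sub_le_count (h : IsConfig a b c p) {x : ℕ} (hx : x ≤ a + b) (y : ℕ) :
    y - c ≤ Nat.count (p x) y := by
  induction x with
  | zero => rw [h.count_zero]
  | succ x ih => exact (ih (by omega)).trans (h.interlaces x (by omega) y).1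

theorem count_le (h : IsConfig a b c p) {x : ℕ} (hx : x ≤ a + b) (y : ℕ) :
    Nat.count (p x) y ≤ min y a + (y - (a + c)) := by
  induction hx using Nat.decreasingInduction with
  | self => rw [h.count_last]
  | of_succ x hx ih => exact (h.interlaces x hx y).1.trans ih

/-- A path rises by at most one per step, so the staircase bound propagates from the left boundary;
`le_count_sub` is its counterpart from the right. -/
theorem count_add_le (h : IsConfig a b c p) {x : ℕ} (hx : x ≤ a + b) (y : ℕ) :
    Nat.count (p x) (y + x) ≤ y - c + x := by
  induction x with
  | zero => simp [h.count_zero]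
  | succ x ih =>
    have h1 := (h.interlaces x (by omega) (y + x)).2
    have h2 := ih (by omega)
    rw [← add_assoc]
    omega

theorem le_count_sub (h : IsConfig a b c p) {x : ℕ} (hx : x ≤ a + b) (y : ℕ) :
    y + (a + b - x) ≤ a → y ≤ Nat.count (p x) y := by
  induction hx using Nat.decreasingInduction generalizing y with
  | self => intro hy; rw [h.count_last]; omega
  | of_succ x hx ih =>
    intro hy
    have h1 := (h.interlaces x (by omega) y).2
    have h2 := ih (y + 1) (by omega)
    omega

theorem count_of_le (h : IsConfig a b c p) {x y : ℕ} (hx : x ≤ a + b) (hy : x + c ≤ y) :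
    Nat.count (p x) y = y - c := by
  have h1 := h.sub_le_count hx y
  have h2 := h.count_add_le hx (y - x)
  rw [Nat.sub_add_cancel (by omega)] at h2
  omega

theorem count_of_ge (h : IsConfig a b c p) {x y : ℕ} (hx : x ≤ a + b) (hy : y + b ≤ x) :
    Nat.count (p x) y = y := by
  have h1 := h.le_count_sub hx y (by omega)
  have h2 : Nat.count (p x) y ≤ y := Nat.count_le _
  omega

theorem count_add (h : IsConfig a b c p) {x : ℕ} (hx : x ≤ a + b) :
    Nat.count (p x) (a + c) = a := by
  have h1 := h.sub_le_count hx (a + c)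
  have h2 := h.count_le hx (a + c)
  omega

/-- Outside the hexagon the bounds from the two boundary lines coincide and force the count to grow
by one at `y`. -/
theorem mem_of_not_verticalEdge (h : IsConfig a b c p) {x y : ℕ}
    (hv : ¬ VerticalEdge a b c x y) : p x y := by
  by_cases hx : x ≤ a + b
  · by_contra hp
    have h0 : Nat.count (p x) (y + 1) = Nat.count (p x) y := by
      rw [Nat.count_succ, if_neg hp, add_zero]
    have h1 := h.count_of_ge (y := y + 1) hx
    have h2 := h.count_of_le (y := y) hx
    have h3 := h.count_of_le (y := y + 1) hx
    have h4 := h.count_of_ge (y := y) hx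
    have h5 := h.sub_le_count hx (y + 1)
    have h6 := h.count_le hx y
    simp only [VerticalEdge] at hv
    omega
  · exact h.beyond x y (by omega)

theorem infinite (h : IsConfig a b c p) (x : ℕ) : (Set.ofPred (p x)).Infinite := by
  refine (Set.Ici_infinite (a + c)).mono fun y (hy : a + c ≤ y) => ?_
  exact h.mem_of_not_verticalEdge fun hv => by simp only [VerticalEdge] at hv; omega

end IsConfig

/-- The positions on the vertical line `x` that are not visited by a lattice path of `T`. -/
def hole (a b c : ℕ) (T : Finset Lozenge) (x y : ℕ) : Prop :=
  ¬ (VerticalEdge a b c x y ∧ Lozenge.horizontal x y ∉ T)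

/-- The local rule that recovers the lozenges of a tiling from its unvisited positions. -/
def rule (p : ℕ → ℕ → Prop) : Lozenge → Prop
  | .horizontal x y => p x.toNat y.toNat
  | .falling x y =>
    Nat.count (p (x.toNat + 1)) (y.toNat + 1) = Nat.count (p x.toNat) y.toNat
  | .rising x y =>
    Nat.count (p (x.toNat + 1)) (y.toNat + 1) = Nat.count (p x.toNat) (y.toNat + 1) + 1

/-- The tiling with prescribed unvisited positions. -/
noncomputable def tilingOf (a b c : ℕ) (p : ℕ → ℕ → Prop) : Finset Lozenge :=
  (finite_lozenge_inHexagon a b c).toFinset.filter (rule p)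

theorem mem_tilingOf {a b c : ℕ} {p : ℕ → ℕ → Prop} {l : Lozenge} :
    l ∈ tilingOf a b c p ↔ l.InHexagon a b c ∧ rule p l := by
  simp [tilingOf]

/-! ### From tilings to interlacing holes -/

section Tiling

variable {a b c : ℕ} {T : Finset Lozenge}

theorem upper_mem_triangles {x y : ℤ} {l : Lozenge} :
    UnitTriangle.upper x y ∈ l.triangles ↔
      l = .horizontal x y ∨ l = .falling x y ∨ l = .rising x y := by
  rcases l with ⟨u, v⟩ | ⟨u, v⟩ | ⟨u, v⟩ <;> simp [Lozenge.triangles, eq_comm]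

theorem lower_mem_triangles {x y : ℤ} {l : Lozenge} :
    UnitTriangle.lower x y ∈ l.triangles ↔
      l = .horizontal (x + 1) y ∨ l = .falling x y ∨ l = .rising x (y - 1) := by
  rcases l with ⟨u, v⟩ | ⟨u, v⟩ | ⟨u, v⟩ <;> simp [Lozenge.triangles] <;> omega

theorem existsUnique_upper {x y : ℤ} :
    (∃! l, l ∈ T ∧ UnitTriangle.upper x y ∈ l.triangles) ↔
      (Lozenge.horizontal x y ∈ T ∨ Lozenge.falling x y ∈ T ∨ Lozenge.rising x y ∈ T) ∧
      ¬ (Lozenge.horizontal x y ∈ T ∧ Lozenge.falling x y ∈ T) ∧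
      ¬ (Lozenge.horizontal x y ∈ T ∧ Lozenge.rising x y ∈ T) ∧
      ¬ (Lozenge.falling x y ∈ T ∧ Lozenge.rising x y ∈ T) := by
  simp only [upper_mem_triangles]
  constructor
  · rintro ⟨l, ⟨hl, h⟩, hu⟩
    have h1 := hu (.horizontal x y)
    have h2 := hu (.falling x y)
    have h3 := hu (.rising x y)
    rcases h with rfl | rfl | rfl <;> simp at h1 h2 h3 <;> tauto
  · rintro ⟨h | h | h, h1, h2, h3⟩
    · exact ⟨_, ⟨h, by simp⟩, by rintro l ⟨hl, rfl | rfl | rfl⟩ <;> simp_all⟩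
    · exact ⟨_, ⟨h, by simp⟩, by rintro l ⟨hl, rfl | rfl | rfl⟩ <;> simp_all⟩
    · exact ⟨_, ⟨h, by simp⟩, by rintro l ⟨hl, rfl | rfl | rfl⟩ <;> simp_all⟩

theorem existsUnique_lower {x y : ℤ} :
    (∃! l, l ∈ T ∧ UnitTriangle.lower x y ∈ l.triangles) ↔
      (Lozenge.horizontal (x + 1) y ∈ T ∨ Lozenge.falling x y ∈ T ∨
        Lozenge.rising x (y - 1) ∈ T) ∧
      ¬ (Lozenge.horizontal (x + 1) y ∈ T ∧ Lozenge.falling x y ∈ T) ∧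
      ¬ (Lozenge.horizontal (x + 1) y ∈ T ∧ Lozenge.rising x (y - 1) ∈ T) ∧
      ¬ (Lozenge.falling x y ∈ T ∧ Lozenge.rising x (y - 1) ∈ T) := by
  simp only [lower_mem_triangles]
  constructor
  · rintro ⟨l, ⟨hl, h⟩, hu⟩
    have h1 := hu (.horizontal (x + 1) y)
    have h2 := hu (.falling x y)
    have h3 := hu (.rising x (y - 1))
    rcases h with rfl | rfl | rfl <;> simp at h1 h2 h3 <;> tauto
  · rintro ⟨h | h | h, h1, h2, h3⟩
    · exact ⟨_, ⟨h, by simp⟩, by rintro l ⟨hl, rfl | rfl | rfl⟩ <;> simp_all⟩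
    · exact ⟨_, ⟨h, by simp⟩, by rintro l ⟨hl, rfl | rfl | rfl⟩ <;> simp_all⟩
    · exact ⟨_, ⟨h, by simp⟩, by rintro l ⟨hl, rfl | rfl | rfl⟩ <;> simp_all⟩

/-- In a tiling, a path leaves the left edge of an upper triangle along a falling or a rising
lozenge. -/
theorem hole_left_iff (hT : IsLozengeTiling a b c T) {x : ℕ} (hx : x < a + b) (y : ℕ) :
    (¬ hole a b c T x y ↔ Lozenge.falling x y ∈ T ∨ Lozenge.rising x y ∈ T) ∧
      ¬ (Lozenge.falling x y ∈ T ∧ Lozenge.rising x y ∈ T) := by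
  by_cases hv : VerticalEdge a b c x y
  · have := existsUnique_upper.1 (hT.2 (.upper x y) (upper_inHexagon.2 ⟨hx, hv⟩))
    simp only [hole]
    tauto
  · have h1 : Lozenge.falling x y ∉ T := fun h => hv (falling_inHexagon.1 (hT.1 _ h)).2
    have h2 : Lozenge.rising x y ∉ T := fun h => hv (rising_inHexagon.1 (hT.1 _ h)).1
    simp only [hole]
    tauto

/-- In a tiling, a path reaches the right edge of a lower triangle along a falling or a rising
lozenge. -/
theorem hole_right_iff (hT : IsLozengeTiling a b c T) (x y : ℕ) :
    (¬ hole a b c T (x + 1) y ↔ Lozenge.falling x y ∈ T ∨ Lozenge.rising x ((y : ℤ) - 1) ∈ T) ∧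
      ¬ (Lozenge.falling x y ∈ T ∧ Lozenge.rising x ((y : ℤ) - 1) ∈ T) := by
  by_cases hv : VerticalEdge a b c (x + 1) y
  · have := existsUnique_lower.1 (hT.2 (.lower x y) (lower_inHexagon.2 hv))
    simp only [hole]
    push_cast
    tauto
  · have h1 : Lozenge.falling x y ∉ T := fun h => hv (falling_inHexagon.1 (hT.1 _ h)).1
    have h2 : Lozenge.rising x ((y : ℤ) - 1) ∉ T := fun h => by
      have := hT.1 _ h (.lower x y) (by simp [Lozenge.triangles])
      exact hv (lower_inHexagon.1 this)
    simp only [hole]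
    tauto

/-- Conservation of paths: below height `y` the two lines differ only by the path, if any, that
crosses this height on a rising lozenge. -/
theorem count_hole_succ_line (hT : IsLozengeTiling a b c T) {x : ℕ} (hx : x < a + b) (y : ℕ) :
    Nat.count (hole a b c T (x + 1)) y =
      Nat.count (hole a b c T x) y + if Lozenge.rising x ((y : ℤ) - 1) ∈ T then 1 else 0 := by
  induction y with
  | zero =>
    rw [if_neg]
    · simp
    · intro h
      -- At height 0 the rising lozenge would have lowest vertex at height `-1`.
      obtain ⟨m, n, -, hn⟩ := exists_nat_rising (hT.1 _ h)
      omega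
  | succ y ih =>
    have h1 := hole_left_iff hT hx y
    have h2 := hole_right_iff hT x y
    rw [Nat.count_succ, Nat.count_succ, ih]
    have h3 : (((y + 1 : ℕ) : ℤ) - 1) = y := by push_cast; ring
    rw [h3]
    by_cases hf : Lozenge.falling x y ∈ T <;> by_cases hr : Lozenge.rising x y ∈ T <;>
      by_cases hr' : Lozenge.rising x ((y : ℤ) - 1) ∈ T <;>
      by_cases hh : hole a b c T x y <;> by_cases hh' : hole a b c T (x + 1) y <;>
      simp_all

theorem count_hole_succ_succ (hT : IsLozengeTiling a b c T) {x : ℕ} (hx : x < a + b) (y : ℕ) :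
    (Nat.count (hole a b c T (x + 1)) (y + 1) + if Lozenge.falling x y ∈ T then 1 else 0) =
      Nat.count (hole a b c T x) y + 1 := by
  have h0 := count_hole_succ_line hT hx y
  have h2 := hole_right_iff hT x y
  rw [Nat.count_succ, h0]
  by_cases hf : Lozenge.falling x y ∈ T <;>
    by_cases hr' : Lozenge.rising x ((y : ℤ) - 1) ∈ T <;>
    by_cases hh' : hole a b c T (x + 1) y <;>
    simp_all

theorem isConfig_hole (hT : IsLozengeTiling a b c T) (ha : 0 < a) (hb : 0 < b) :
    IsConfig a b c (hole a b c T) where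
  zero y := by
    have : Lozenge.horizontal (0 : ℕ) y ∉ T := fun h => by
      have := horizontal_inHexagon.1 (hT.1 _ h)
      omega
    simp only [hole, this, VerticalEdge]
    simp
    omega
  last y := by
    have : Lozenge.horizontal (a + b : ℕ) y ∉ T := fun h => by
      have := horizontal_inHexagon.1 (hT.1 _ h)
      omega
    simp only [hole, this, VerticalEdge]
    simp
    omega
  beyond x y hx := by
    simp only [hole, VerticalEdge]
    omega
  interlaces x hx y := by
    have h1 := count_hole_succ_line hT hx y
    have h2 := count_hole_succ_succ hT hx y
    omega

/-- The two count identities turn membership of a falling or rising lozenge into exactly the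
equation tested by `rule`. -/
theorem tilingOf_hole (hT : IsLozengeTiling a b c T) : tilingOf a b c (hole a b c T) = T := by
  ext l
  rw [mem_tilingOf]
  have hin : l ∈ T → l.InHexagon a b c := hT.1 l
  rw [← and_iff_right_of_imp hin]
  refine and_congr_right fun hl => ?_
  rcases l with ⟨x, y⟩ | ⟨x, y⟩ | ⟨x, y⟩
  · obtain ⟨m, n, rfl, rfl⟩ := exists_nat_horizontal hl
    have := horizontal_inHexagon.1 hl
    simp only [rule, hole, Int.toNat_natCast]
    tauto
  · obtain ⟨m, n, rfl, rfl⟩ := exists_nat_falling hl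
    have hv := (falling_inHexagon.1 hl).1.1
    have := count_hole_succ_succ hT (x := m) (by omega) n
    simp only [rule, Int.toNat_natCast]
    split_ifs at this with h <;> simp only [h, iff_true, iff_false] <;> omega
  · obtain ⟨m, n, rfl, rfl⟩ := exists_nat_rising hl
    have hv := (rising_inHexagon.1 hl).2.1
    have := count_hole_succ_line hT (x := m) (by omega) (n + 1)
    have h3 : (((n + 1 : ℕ) : ℤ) - 1) = n := by push_cast; ring
    rw [h3] at this
    simp only [rule, Int.toNat_natCast]
    split_ifs at this with h <;> simp only [h, iff_true, iff_false] <;> omega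

end Tiling

/-! ### From interlacing holes to tilings -/

section Config

variable {a b c : ℕ} {p : ℕ → ℕ → Prop}

theorem horizontal_mem_tilingOf (x y : ℕ) :
    Lozenge.horizontal x y ∈ tilingOf a b c p ↔
      (1 ≤ x ∧ x < a + b ∧ VerticalEdge a b c x y) ∧ p x y := by
  rw [mem_tilingOf, horizontal_inHexagon]
  rfl

theorem falling_mem_tilingOf (x y : ℕ) :
    Lozenge.falling x y ∈ tilingOf a b c p ↔
      (VerticalEdge a b c (x + 1) y ∧ VerticalEdge a b c x y) ∧
        Nat.count (p (x + 1)) (y + 1) = Nat.count (p x) y := by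
  rw [mem_tilingOf, falling_inHexagon]
  rfl

theorem rising_mem_tilingOf (x y : ℕ) :
    Lozenge.rising x y ∈ tilingOf a b c p ↔
      (VerticalEdge a b c x y ∧ VerticalEdge a b c (x + 1) (y + 1)) ∧
        Nat.count (p (x + 1)) (y + 1) = Nat.count (p x) (y + 1) + 1 := by
  rw [mem_tilingOf, rising_inHexagon]
  rfl

/-- Interlacing leaves each count difference two possible values, which makes exactly one of the
three candidate lozenges at a triangle satisfy its rule; the forced counts handle the border. -/
theorem isLozengeTiling_tilingOf (h : IsConfig a b c p) :
    IsLozengeTiling a b c (tilingOf a b c p) := by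
  refine ⟨fun l hl => (mem_tilingOf.1 hl).1, ?_⟩
  rintro (⟨x, y⟩ | ⟨x, y⟩) ht
  · have h0 := nonneg_of_lower_inHexagon ht
    lift x to ℕ using h0.1
    lift y to ℕ using h0.2
    have hv := lower_inHexagon.1 ht
    have hx : x < a + b := by have := hv.1; omega
    have hc : (x : ℤ) + 1 = ((x + 1 : ℕ) : ℤ) := by push_cast; ring
    have hI := h.interlaces x hx
    have hIy := hI y
    have hs := Nat.count_succ (p (x + 1)) y
    have hlast : x + 1 = a + b → ¬ p (x + 1) y := by
      intro hxe
      simp only [VerticalEdge] at hv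
      rw [hxe, h.last]
      omega
    -- On the border `y = x + c` the falling lozenge would leave the hexagon; the forced counts show
    -- that its rule fails there.
    have h2 := h.count_of_le (x := x) (y := y) (by omega)
    have h3 := h.count_of_le (x := x + 1) (y := y + 1) (by omega)
    rw [existsUnique_lower, hc, horizontal_mem_tilingOf, falling_mem_tilingOf]
    rcases y with _ | y
    · have hr : Lozenge.rising x (((0 : ℕ) : ℤ) - 1) ∉ tilingOf a b c p := fun hm => by
        obtain ⟨m, n, -, hn⟩ := exists_nat_rising (mem_tilingOf.1 hm).1
        omega
      simp only [hr, and_false, not_false_eq_true, and_true, or_false]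
      simp only [VerticalEdge] at hv ⊢
      by_cases hp : p (x + 1) 0 <;> simp only [hp, if_true, if_false, not_true_eq_false, not_false_eq_true, imp_false, implies_true, and_true, and_false,
        false_and, false_or] at hs hlast ⊢ <;>
        simp only [Nat.count_zero] at * <;> omega
    · have hy : (((y + 1 : ℕ) : ℤ) - 1) = y := by push_cast; ring
      rw [hy, rising_mem_tilingOf]
      have h4 := h.count_of_ge (x := x) (y := y + 1) (by omega)
      have h5 : Nat.count (p (x + 1)) (y + 1) ≤ y + 1 := Nat.count_le _
      simp only [VerticalEdge] at hv ⊢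
      by_cases hp : p (x + 1) (y + 1) <;> simp only [hp, if_true, if_false, not_true_eq_false, not_false_eq_true, imp_false, implies_true, and_true, and_false,
        false_and, true_and, false_or] at hs hlast ⊢ <;>
        omega
  · have h0 := nonneg_of_upper_inHexagon ht
    lift x to ℕ using h0.1
    lift y to ℕ using h0.2
    obtain ⟨hx, hv⟩ := upper_inHexagon.1 ht
    have hIy := h.interlaces x hx y
    have hIy' := h.interlaces x hx (y + 1)
    have hs := Nat.count_succ (p x) y
    have hzero : x = 0 → ¬ p x y := by
      intro hxe
      simp only [VerticalEdge] at hv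
      rw [hxe, h.zero]
      omega
    -- The falling lozenge leaves the hexagon when `x = y + b`, the rising one when `y + 1 = a + c`;
    -- the forced counts refute their rules there.
    have h2 := h.count_of_ge (x := x) (y := y) (by omega)
    have h3 := h.count_of_ge (x := x + 1) (y := y + 1) (by omega)
    have h4 := h.count_add (x := x) (by omega)
    have h5 := h.count_add (x := x + 1) (by omega)
    have h6 : y + 1 = a + c → Nat.count (p x) (y + 1) = a := fun e => e ▸ h4
    have h7 : y + 1 = a + c → Nat.count (p (x + 1)) (y + 1) = a := fun e => e ▸ h5
    rw [existsUnique_upper, horizontal_mem_tilingOf, falling_mem_tilingOf, rising_mem_tilingOf]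
    simp only [VerticalEdge] at hv ⊢
    by_cases hp : p x y <;> simp only [hp, if_true, if_false, not_true_eq_false, not_false_eq_true, imp_false, implies_true, and_true, and_false,
        false_and, true_and, false_or] at hs hzero ⊢ <;> omega

theorem hole_tilingOf (h : IsConfig a b c p) : hole a b c (tilingOf a b c p) = p := by
  funext x y
  rw [eq_iff_iff, hole, horizontal_mem_tilingOf]
  by_cases hv : VerticalEdge a b c x y
  · have hzero : x = 0 → ¬ p x y := by
      rintro rfl
      simp only [VerticalEdge] at hv
      rw [h.zero]
      omega
    have hlast : x = a + b → ¬ p x y := by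
      rintro rfl
      simp only [VerticalEdge] at hv
      rw [h.last]
      omega
    have hx := hv.1
    have h1 : p x y → 1 ≤ x ∧ x < a + b := fun hp => by
      by_contra hcon
      rcases Nat.eq_zero_or_pos x with h0 | h0
      · exact hzero h0 hp
      · exact hlast (by omega) hp
    tauto
  · have := h.mem_of_not_verticalEdge hv
    tauto

theorem isConfig_toggle (h : IsConfig a b c p) {x : ℕ} (hx : x + 1 < a + b) :
    IsConfig a b c (Function.update p (x + 1) (toggle (p x) (p (x + 1)) (p (x + 2)))) := by
  have ht := interlaces_toggle (h.infinite x) (h.infinite (x + 1)) (h.infinite (x + 2))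
    (h.interlaces x (by omega)) (h.interlaces (x + 1) hx)
  refine ⟨fun y => ?_, fun y => ?_, fun z y hz => ?_, fun z hz => ?_⟩
  · rw [Function.update_of_ne (by omega)]
    exact h.zero y
  · rw [Function.update_of_ne (by omega)]
    exact h.last y
  · rw [Function.update_of_ne (by omega)]
    exact h.beyond z y hz
  · rcases eq_or_ne z x with rfl | h1
    · rw [Function.update_self, Function.update_of_ne (by omega)]
      exact ht.1
    · rcases eq_or_ne z (x + 1) with rfl | h2
      · rw [Function.update_self, Function.update_of_ne (by omega)]
        exact ht.2
      · rw [Function.update_of_ne h2, Function.update_of_ne (by omega)]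
        exact h.interlaces z hz

/-- A configuration in which the lattice paths first rise and then run flat. -/
theorem exists_isConfig (a b c : ℕ) : ∃ p, IsConfig a b c p := by
  let g : ℕ → ℕ → ℕ := fun x i => if i < x ∧ i < a then i else i + c
  have hg : ∀ x i, g (x + 1) i ≤ g x i ∧ g x i < g (x + 1) (i + 1) := by
    intro x i
    simp only [g]
    split_ifs <;> omega
  have hmono : ∀ x, StrictMono (g x) := fun x => strictMono_nat_of_lt_succ fun i => by
    simp only [g]
    split_ifs <;> omega
  have hinf : ∀ x, (Set.ofPred fun y => y ∈ Set.range (g x)).Infinite := fun x =>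
    Set.infinite_range_of_injective (hmono x).injective
  refine ⟨fun x y => a + b < x ∨ y ∈ Set.range (g x), fun y => ?_, fun y => ?_,
    fun x y hx => Or.inl hx, fun x hx => ?_⟩
  · simp only [g, Set.mem_range]
    constructor
    · rintro (h | ⟨i, hi⟩)
      · omega
      · split_ifs at hi <;> omega
    · exact fun h => Or.inr ⟨y - c, by split_ifs <;> omega⟩
  · simp only [g, Set.mem_range]
    constructor
    · rintro (h | ⟨i, hi⟩)
      · omega
      · split_ifs at hi <;> omega
    · rintro (h | h)
      · exact Or.inr ⟨y, by split_ifs <;> omega⟩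
      · exact Or.inr ⟨y - c, by split_ifs <;> omega⟩
  · have e : ∀ z ≤ a + b, (fun y => a + b < z ∨ y ∈ Set.range (g z)) =
        fun y => y ∈ Set.range (g z) := fun z hz => by
      funext y
      simp [hz.not_gt]
    rw [e x (by omega), e (x + 1) (by omega), interlaces_iff_nth (hinf x) (hinf (x + 1))]
    intro i
    rw [nth_mem_range_eq (hmono _), nth_mem_range_eq (hmono _), nth_mem_range_eq (hmono _)]
    exact hg x i

end Config

end Configurations

end LozengeHexagon

namespace LozengeHexagon

/-! ### The toggling involution on tilings and the expected hole sum -/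

section Expectation

open scoped Classical

/-- The sum of the unvisited positions below `a + c` on the vertical line `x`. -/
noncomputable def lineSum (a b c : ℕ) (T : Finset Lozenge) (x : ℕ) : ℕ :=
  ∑ y ∈ Finset.range (a + c), if hole a b c T x y then y else 0

/-- The finite set of all lozenge tilings. -/
noncomputable def tilings (a b c : ℕ) : Finset (Finset Lozenge) :=
  (finite_lozengeTilings a b c).toFinset

/-- The tiling obtained by reflecting the unvisited positions of the line `x + 1`. -/
noncomputable def toggleTiling (a b c x : ℕ) (T : Finset Lozenge) : Finset Lozenge :=
  tilingOf a b c (Function.update (hole a b c T) (x + 1)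
    (toggle (hole a b c T x) (hole a b c T (x + 1)) (hole a b c T (x + 2))))

variable {a b c : ℕ} {T : Finset Lozenge}

theorem mem_tilings : T ∈ tilings a b c ↔ IsLozengeTiling a b c T := by
  simp [tilings, lozengeTilings]

theorem card_tilings_pos (a b c : ℕ) : 0 < (tilings a b c).card := by
  obtain ⟨p, hp⟩ := exists_isConfig a b c
  exact Finset.card_pos.2 ⟨_, mem_tilings.2 (isLozengeTiling_tilingOf hp)⟩

section

variable (ha : 0 < a) (hb : 0 < b) {x : ℕ} (hx : x + 1 < a + b)

include ha hb hx

theorem hole_toggleTiling (hT : IsLozengeTiling a b c T) :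
    hole a b c (toggleTiling a b c x T) = Function.update (hole a b c T) (x + 1)
      (toggle (hole a b c T x) (hole a b c T (x + 1)) (hole a b c T (x + 2))) :=
  hole_tilingOf (isConfig_toggle (isConfig_hole hT ha hb) hx)

theorem isLozengeTiling_toggleTiling (hT : IsLozengeTiling a b c T) :
    IsLozengeTiling a b c (toggleTiling a b c x T) :=
  isLozengeTiling_tilingOf (isConfig_toggle (isConfig_hole hT ha hb) hx)

theorem toggleTiling_toggleTiling (hT : IsLozengeTiling a b c T) :
    toggleTiling a b c x (toggleTiling a b c x T) = T := by
  have h := isConfig_hole hT ha hb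
  conv_lhs => rw [toggleTiling]
  rw [hole_toggleTiling ha hb hx hT, Function.update_self,
    Function.update_of_ne (show x ≠ x + 1 by omega),
    Function.update_of_ne (show x + 2 ≠ x + 1 by omega),
    toggle_toggle (h.infinite x) (h.infinite (x + 1)) (h.infinite (x + 2))
      (h.interlaces x (by omega)) (h.interlaces (x + 1) hx),
    Function.update_idem, Function.update_eq_self, tilingOf_hole hT]

theorem lineSum_add_lineSum_toggleTiling (hT : IsLozengeTiling a b c T) :
    lineSum a b c T (x + 1) + lineSum a b c (toggleTiling a b c x T) (x + 1) =
      lineSum a b c T x + lineSum a b c T (x + 2) := by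
  have h := isConfig_hole hT ha hb
  have h' := isConfig_toggle h hx
  have hcount := h'.count_add (x := x + 1) (by omega)
  rw [Function.update_self] at hcount
  unfold lineSum
  rw [hole_toggleTiling ha hb hx hT, Function.update_self]
  exact sum_add_sum_toggle (h.infinite x) (h.infinite (x + 1)) (h.infinite (x + 2))
      (h.interlaces x (by omega)) (h.interlaces (x + 1) hx) (h.count_add (by omega))
      (h.count_add (by omega)) (h.count_add (by omega)) hcount

/-- Toggling permutes the tilings, so one of the two equal sums may be taken over toggled tilings;
the identity then holds tiling by tiling. -/
theorem sum_lineSum_harmonic :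
    ∑ T ∈ tilings a b c, lineSum a b c T (x + 1) + ∑ T ∈ tilings a b c, lineSum a b c T (x + 1) =
      ∑ T ∈ tilings a b c, lineSum a b c T x + ∑ T ∈ tilings a b c, lineSum a b c T (x + 2) := by
  have h1 : ∑ T ∈ tilings a b c, lineSum a b c T (x + 1) =
      ∑ T ∈ tilings a b c, lineSum a b c (toggleTiling a b c x T) (x + 1) := by
    refine Finset.sum_nbij' (toggleTiling a b c x) (toggleTiling a b c x) ?_ ?_ ?_ ?_ ?_
    · exact fun T hT => mem_tilings.2 (isLozengeTiling_toggleTiling ha hb hx (mem_tilings.1 hT))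
    · exact fun T hT => mem_tilings.2 (isLozengeTiling_toggleTiling ha hb hx (mem_tilings.1 hT))
    · exact fun T hT => toggleTiling_toggleTiling ha hb hx (mem_tilings.1 hT)
    · exact fun T hT => toggleTiling_toggleTiling ha hb hx (mem_tilings.1 hT)
    · intro T hT
      rw [toggleTiling_toggleTiling ha hb hx (mem_tilings.1 hT)]
  conv_lhs => arg 2; rw [h1]
  rw [← Finset.sum_add_distrib, ← Finset.sum_add_distrib]
  exact Finset.sum_congr rfl fun T hT =>
    lineSum_add_lineSum_toggleTiling ha hb hx (mem_tilings.1 hT)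

end

/-! ### Affine interpolation and the contribution outside the hexagon -/

theorem eq_affine_of_harmonic {A : ℕ → ℝ} {n : ℕ}
    (hA : ∀ x, x + 1 < n → A (x + 1) + A (x + 1) = A x + A (x + 2)) {x : ℕ} (hx : x ≤ n) :
    A x = A 0 + x * (A 1 - A 0) := by
  induction x using Nat.twoStepInduction with
  | zero => simp
  | one => simp
  | more x h1 h2 =>
    have := hA x (by omega)
    rw [h1 (by omega), h2 (by omega)] at this
    push_cast at this ⊢
    linarith

theorem sum_range_ite_lt (m : ℝ) {k n : ℕ} (h : k ≤ n) :
    ∑ y ∈ Finset.range n, (if y < k then (y : ℝ) - m else 0) = k * (k - 1) / 2 - k * m := by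
  rw [← Finset.sum_filter]
  have : (Finset.range n).filter (· < k) = Finset.range k := by ext; simp; omega
  rw [this]
  clear this h
  induction k with
  | zero => simp
  | succ k ih => rw [Finset.sum_range_succ, ih]; push_cast; ring

theorem sum_range_ite_le (m : ℝ) {k n : ℕ} (h : k ≤ n) :
    ∑ y ∈ Finset.range n, (if k ≤ y then (y : ℝ) - m else 0) =
      n * (n - 1) / 2 - n * m - (k * (k - 1) / 2 - k * m) := by
  have h1 := sum_range_ite_lt m h
  have h2 := sum_range_ite_lt m (le_refl n)
  have h3 : ∑ y ∈ Finset.range n, (if y < n then (y : ℝ) - m else 0) =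
      ∑ y ∈ Finset.range n, (if k ≤ y then (y : ℝ) - m else 0) +
      ∑ y ∈ Finset.range n, (if y < k then (y : ℝ) - m else 0) := by
    rw [← Finset.sum_add_distrib]
    refine Finset.sum_congr rfl fun y hy => ?_
    have := Finset.mem_range.1 hy
    by_cases hk : k ≤ y
    · simp [hk, this, hk.not_gt]
    · simp [hk, this, not_le.1 hk]
  linarith

theorem lineSum_zero (h : IsConfig a b c (hole a b c T)) :
    (lineSum a b c T 0 : ℝ) = a * (a - 1) / 2 + a * c := by
  have := sum_range_ite_le 0 (show c ≤ a + c by omega)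
  simp only [lineSum, h.zero]
  push_cast at this ⊢
  simp only [sub_zero] at this
  rw [this]
  ring

theorem lineSum_last (h : IsConfig a b c (hole a b c T)) :
    (lineSum a b c T (a + b) : ℝ) = a * (a - 1) / 2 := by
  have := sum_range_ite_lt 0 (show a ≤ a + c by omega)
  simp only [lineSum, h.last]
  push_cast at this ⊢
  simp only [sub_zero, mul_zero] at this
  rw [← this]
  refine Finset.sum_congr rfl fun y hy => ?_
  have := Finset.mem_range.1 hy
  simp [this.not_ge]

theorem sum_lineSum (ha : 0 < a) (hb : 0 < b) {x : ℕ} (hx : x ≤ a + b) :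
    ∑ T ∈ tilings a b c, (lineSum a b c T x : ℝ) =
      (tilings a b c).card * (a * (a - 1) / 2 + a * c * (a + b - x) / (a + b)) := by
  have hA : ∀ z, z + 1 < a + b → _ := fun z hz =>
    congrArg (Nat.cast : ℕ → ℝ) (sum_lineSum_harmonic (c := c) ha hb hz)
  push_cast at hA
  have h0 : ∑ T ∈ tilings a b c, (lineSum a b c T 0 : ℝ) =
      (tilings a b c).card * (a * (a - 1) / 2 + a * c) := by
    rw [Finset.sum_congr rfl fun T hT =>
      lineSum_zero (isConfig_hole (mem_tilings.1 hT) ha hb), Finset.sum_const, nsmul_eq_mul]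
  have hn : ∑ T ∈ tilings a b c, (lineSum a b c T (a + b) : ℝ) =
      (tilings a b c).card * (a * (a - 1) / 2) := by
    rw [Finset.sum_congr rfl fun T hT =>
      lineSum_last (isConfig_hole (mem_tilings.1 hT) ha hb), Finset.sum_const, nsmul_eq_mul]
  have e1 := eq_affine_of_harmonic (A := fun z => ∑ T ∈ tilings a b c, (lineSum a b c T z : ℝ))
    hA hx
  have e2 := eq_affine_of_harmonic (A := fun z => ∑ T ∈ tilings a b c, (lineSum a b c T z : ℝ))
    hA le_rfl
  simp only [h0, hn] at e1 e2
  have hab : (a : ℝ) + b ≠ 0 := by positivity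
  rw [e1]
  generalize ∑ T ∈ tilings a b c, (lineSum a b c T 1 : ℝ) = s at e2 ⊢
  push_cast at e2
  field_simp
  linear_combination (2 * (x : ℝ)) * (-e2)

theorem prob_eq (x y : ℕ) :
    prob a b c x y = (∑ T ∈ tilings a b c, if Lozenge.horizontal x y ∈ T then (1 : ℝ) else 0) /
      (tilings a b c).card := by
  have h1 : (lozengeTilings a b c).ncard = (tilings a b c).card :=
    Set.ncard_eq_toFinset_card _ (finite_lozengeTilings a b c)
  have h2 : {T ∈ lozengeTilings a b c | Lozenge.horizontal x y ∈ T} =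
      ((tilings a b c).filter fun T => Lozenge.horizontal x y ∈ T : Finset (Finset Lozenge)) := by
    ext T
    simp [tilings]
  rw [prob, h1, h2, Set.ncard_coe_finset, Finset.sum_boole]

/-- Horizontal lozenges are the holes inside the hexagon, and recentring at `m` costs `a * m`
because every line has `a` holes below `a + c`. -/
theorem sum_horizontal {T : Finset Lozenge} (hT : IsLozengeTiling a b c T) (ha : 0 < a)
    (hb : 0 < b) (m : ℝ) {x : ℕ} (hx : x ≤ a + b) :
    ∑ y ∈ Finset.range (a + c), (if Lozenge.horizontal x y ∈ T then (y : ℝ) - m else 0) =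
      lineSum a b c T x - a * m -
        ∑ y ∈ Finset.range (a + c), if VerticalEdge a b c x y then 0 else (y : ℝ) - m := by
  have h1 : (a : ℝ) = ∑ y ∈ Finset.range (a + c), if hole a b c T x y then (1 : ℝ) else 0 := by
    rw [Finset.sum_boole, ← Nat.count_eq_card_filter_range,
      (isConfig_hole hT ha hb).count_add hx]
  have h2 : (a : ℝ) * m = ∑ y ∈ Finset.range (a + c), if hole a b c T x y then m else 0 := by
    rw [h1, Finset.sum_mul]
    exact Finset.sum_congr rfl fun y _ => by split_ifs <;> simp
  rw [h2, lineSum]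
  push_cast
  rw [← Finset.sum_sub_distrib, ← Finset.sum_sub_distrib]
  refine Finset.sum_congr rfl fun y _ => ?_
  have h3 : Lozenge.horizontal x y ∈ T → VerticalEdge a b c x y := fun h =>
    (horizontal_inHexagon.1 (hT.1 _ h)).2.2
  by_cases hv : VerticalEdge a b c x y <;> by_cases hl : Lozenge.horizontal x y ∈ T
  · simp [hole, hv, hl]
  · simp [hole, hv, hl]
  · exact absurd (h3 hl) hv
  · simp [hole, hv, hl]

/-- The positions outside form an initial segment `y < x - b`, empty by truncation when `x ≤ b`, and
a final segment `min x a + c ≤ y`. -/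
theorem sum_not_verticalEdge (m : ℝ) {x : ℕ} (hx : x ≤ a + b) :
    ∑ y ∈ Finset.range (a + c), (if VerticalEdge a b c x y then 0 else (y : ℝ) - m) =
      ((x - b : ℕ) * ((x - b : ℕ) - 1) / 2 - (x - b : ℕ) * m) +
        (((a + c : ℕ) : ℝ) * ((a + c : ℕ) - 1) / 2 - (a + c : ℕ) * m -
          ((min x a + c : ℕ) * ((min x a + c : ℕ) - 1) / 2 - (min x a + c : ℕ) * m)) := by
  rw [← sum_range_ite_lt m (show x - b ≤ a + c by omega),
    ← sum_range_ite_le m (show min x a + c ≤ a + c by omega), ← Finset.sum_add_distrib]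
  refine Finset.sum_congr rfl fun y hy => ?_
  have hy := Finset.mem_range.1 hy
  have hv : VerticalEdge a b c x y ↔ ¬ y < x - b ∧ ¬ min x a + c ≤ y := by
    simp only [VerticalEdge]
    omega
  by_cases h1 : y < x - b
  · rw [if_neg fun h => (hv.1 h).1 h1, if_pos h1, if_neg (by omega), add_zero]
  · by_cases h2 : min x a + c ≤ y
    · rw [if_neg fun h => (hv.1 h).2 h2, if_neg h1, if_pos h2, zero_add]
    · rw [if_pos (hv.2 ⟨h1, h2⟩), if_neg h1, if_neg h2, add_zero]

theorem sum_prob_mul (ha : 0 < a) (hb : 0 < b) {x : ℕ} (hx : x ≤ a + b) :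
    ∑ y ∈ Finset.range (a + c), prob a b c x y * ((y : ℝ) - ((a : ℝ) + c - 1) / 2) =
      a * c * (a + b - x) / (a + b) - a * c / 2 +
        ((x - b : ℕ) : ℝ) * (a + c - (x - b : ℕ)) / 2 -
        ((min x a + c : ℕ) : ℝ) * (a - (min x a : ℕ)) / 2 := by
  have hN : ((tilings a b c).card : ℝ) ≠ 0 := by
    exact_mod_cast (card_tilings_pos a b c).ne'
  set m : ℝ := ((a : ℝ) + c - 1) / 2 with hm
  have h1 : ∑ y ∈ Finset.range (a + c), prob a b c x y * ((y : ℝ) - m) =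
      (∑ T ∈ tilings a b c, ∑ y ∈ Finset.range (a + c),
        if Lozenge.horizontal x y ∈ T then (y : ℝ) - m else 0) / (tilings a b c).card := by
    rw [Finset.sum_comm, Finset.sum_div]
    refine Finset.sum_congr rfl fun y _ => ?_
    rw [prob_eq, div_mul_eq_mul_div, Finset.sum_mul]
    congr 1
    exact Finset.sum_congr rfl fun T _ => by split_ifs <;> simp
  rw [h1, Finset.sum_congr rfl fun T hT => sum_horizontal (mem_tilings.1 hT) ha hb m hx,
    sum_not_verticalEdge m hx, Finset.sum_sub_distrib, Finset.sum_sub_distrib,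
    sum_lineSum ha hb hx, Finset.sum_const, Finset.sum_const, nsmul_eq_mul, nsmul_eq_mul,
    ← mul_sub, ← mul_sub, mul_div_cancel_left₀ _ hN, hm]
  push_cast
  ring

end Expectation

end LozengeHexagon

theorem lemma3 (a b c x₀ : ℕ) (ha : 0 < a) (hb : 0 < b) (hc : 0 < c)
    (hx₁ : 1 ≤ x₀) (hx₂ : x₀ ≤ a + b - 1) :
    (a ≤ b →
      (x₀ ≤ a →
        ∑ y ∈ Finset.range (a + c),
            LozengeHexagon.prob a b c x₀ y * ((y : ℝ) - ((a : ℝ) + c - 1) / 2) =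
          (-(a : ℝ) ^ 2 - a * b - a * c + b * c + a * x₀ + b * x₀) * x₀ / (2 * (a + b))) ∧
      (a ≤ x₀ → x₀ ≤ b →
        ∑ y ∈ Finset.range (a + c),
            LozengeHexagon.prob a b c x₀ y * ((y : ℝ) - ((a : ℝ) + c - 1) / 2) =
          (a : ℝ) * c * (a + b - 2 * x₀) / (2 * (a + b))) ∧
      (b ≤ x₀ →
        ∑ y ∈ Finset.range (a + c),
            LozengeHexagon.prob a b c x₀ y * ((y : ℝ) - ((a : ℝ) + c - 1) / 2) =
          (-(b : ℝ) ^ 2 - a * b - b * c + a * c + a * x₀ + b * x₀) * (a + b - x₀) /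
            (2 * (a + b)))) ∧
    (b ≤ a →
      (x₀ ≤ b →
        ∑ y ∈ Finset.range (a + c),
            LozengeHexagon.prob a b c x₀ y * ((y : ℝ) - ((a : ℝ) + c - 1) / 2) =
          (-(a : ℝ) ^ 2 - a * b - a * c + b * c + a * x₀ + b * x₀) * x₀ / (2 * (a + b))) ∧
      (b ≤ x₀ → x₀ ≤ a →
        ∑ y ∈ Finset.range (a + c),
            LozengeHexagon.prob a b c x₀ y * ((y : ℝ) - ((a : ℝ) + c - 1) / 2) =
          -(b : ℝ) * (a + b + c) * (a + b - 2 * x₀) / (2 * (a + b))) ∧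
      (a ≤ x₀ →
        ∑ y ∈ Finset.range (a + c),
            LozengeHexagon.prob a b c x₀ y * ((y : ℝ) - ((a : ℝ) + c - 1) / 2) =
          (-(b : ℝ) ^ 2 - a * b - b * c + a * c + a * x₀ + b * x₀) * (a + b - x₀) /
            (2 * (a + b)))) := by
  have hab : (a : ℝ) + b ≠ 0 := by positivity
  have H := LozengeHexagon.sum_prob_mul (c := c) ha hb (x := x₀) (by omega)
  rw [H]
  clear H
  -- Each case fixes the value of `min x₀ a` and of the truncated difference `x₀ - b`; what remains
  -- is a rational identity.
  refine ⟨fun h => ⟨fun h1 => ?_, fun h1 h2 => ?_, fun h1 => ?_⟩,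
    fun h => ⟨fun h1 => ?_, fun h1 h2 => ?_, fun h1 => ?_⟩⟩
  · rw [min_eq_left h1, Nat.sub_eq_zero_of_le (h1.trans h)]
    push_cast
    field_simp
    ring
  · rw [min_eq_right h1, Nat.sub_eq_zero_of_le h2]
    push_cast
    field_simp
    ring
  · rw [min_eq_right (h.trans h1)]
    push_cast [Nat.cast_sub h1]
    field_simp
    ring
  · rw [min_eq_left (h1.trans h), Nat.sub_eq_zero_of_le h1]
    push_cast
    field_simp
    ring
  · rw [min_eq_left h2]
    push_cast [Nat.cast_sub h1]
    field_simp
    ring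
  · rw [min_eq_right h1]
    push_cast [Nat.cast_sub (h.trans h1)]
    field_simp
    ring
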